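/- Let $f:\mathbb{R}\to\mathbb{R}$ be an odd function that is given on all of $\mathbb{R}$ by its Taylor series at $0$, $f(x)=\sum_{n\ge 0}\frac{f^{(n)}(0)}{n!}x^n$, and whose derivatives at $0$ are bounded: $\sup_n|f^{(n)}(0)|<\infty$. For $k\ge 0$ put $$F_k(x)=\sum_{u\ge 0}\frac{f^{(2u+k)}(0)}{u!}x^u,\qquad \kappa=\sum_{k\text{ odd}}\frac{F_k(1/2)^2}{k!},\qquad \lambda=F_1(1/2)^2 .$$ If $f$ is not identically zero, then $\kappa>0$. Moreover, for every $K$ there is a constant $C$, depending only on $f$ and $K$, such that the following holds. Let $B$ be a real symmetric $d\times d$ matrix with $B_{ii}=0$ for all $i$ and operator norm (with respect to the Euclidean norm) $\|B\|\le\delta<1$, put $\epsilon=\delta/(1-\delta)$, and suppose $d\epsilon\le K$. Let $X$ be a centred Gaussian vector in $\mathbb{R}^d$ with precision matrix $I+B$, that is, with covariance matrix $(I+B)^{-1}$. Then each $f(X_i)$ has finite second moment, and, writing the covariance matrix $\tau$ of $(f(X_1),\dots,f(X_d))$ as $$\tau=\kappa I-\lambda B+E',$$ one has $\|E'\|\le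 C\epsilon^2$. Consequently, if $f$ is not identically zero, then $\tau$ is invertible and $$\Bigl\|\tau^{-1}-\Bigl(\frac1\kappa I+\frac{\lambda}{\kappa^2}B\Bigr)\Bigr\|\le C\epsilon^2 .$$ -/

import Mathlib

open MeasureTheory ProbabilityTheory
open scoped Matrix.Norms.L2Operator

/-- `F_k(x) = ∑_{u ≥ 0} f^{(2u+k)}(0) / u! * x^u`. -/
noncomputable def taylorF (f : ℝ → ℝ) (k : ℕ) (x : ℝ) : ℝ :=
  ∑' u : ℕ, iteratedDeriv (2 * u + k) f 0 / (u.factorial : ℝ) * x ^ u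

/-- `κ = ∑_{k odd} F_k(1/2)^2 / k!`, the odd index being written `k = 2s+1`. -/
noncomputable def kappa (f : ℝ → ℝ) : ℝ :=
  ∑' s : ℕ, taylorF f (2 * s + 1) (1 / 2) ^ 2 / ((2 * s + 1).factorial : ℝ)

/-- `λ = F_1(1/2)^2`. -/
noncomputable def lam (f : ℝ → ℝ) : ℝ := taylorF f 1 (1 / 2) ^ 2

/-- The law of a centred Gaussian vector in `ℝ^d` with precision matrix `Γ`,
i.e. with covariance matrix `Γ⁻¹`. -/
noncomputable def gaussianOfPrecision {d : ℕ} (Γ : Matrix (Fin d) (Fin d) ℝ) :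
    Measure (EuclideanSpace ℝ (Fin d)) :=
  multivariateGaussian 0 Γ⁻¹

/-- The covariance matrix of `(f (X_1), …, f (X_d))`, where `X` is a centred Gaussian vector
with precision matrix `Γ`. -/
noncomputable def transformedCov {d : ℕ} (f : ℝ → ℝ) (Γ : Matrix (Fin d) (Fin d) ℝ) :
    Matrix (Fin d) (Fin d) ℝ :=
  Matrix.of fun i j => cov[fun x => f (x i), fun x => f (x j); gaussianOfPrecision Γ]

/-! Write `S = (1 + B)⁻¹` and let `a` be the derivatives of `f` at `0`. Integrating the double
Taylor series termwise, with Gaussian mixed moments read off from the moment generating function,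
gives the exact formula `Cov(f(X_i), f(X_j)) = ∑_k F_k(S_ii/2) F_k(S_jj/2) S_ij^k / k!`
(`integral_mul_eq_heatPairing`, `covariance_comp_eval`).

Expansion: `S - 1 + B` has norm at most `ε²`, and `B` has zero diagonal, so `S_ii = 1 + O(ε²)` while
`S_ij = O(ε)` off the diagonal. Oddness kills the even `k`, so an off-diagonal entry is `λ S_ij +
O(ε³)`; the missing `k = 2` term is what matters, since summing over `d` columns costs a factor `d`,
and `d ε³ ≤ K ε²`. The diagonal is `κ + O(ε²)`, with no dimension factor.

Inversion: `C ε²` need not be small against `κ`, so a Neumann series is not enough. Instead `S ≥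
1/2`, and the Schur product theorem gives `S^{∘k} ≥ 2^{-k}` for `k ≥ 1`; hence `τ` is bounded below
by the diagonal matrix with entries `∑_k F_k(S_ii/2)² 2^{-k} / k!`. These are bounded below by
compactness and strict positivity, the latter because `F_k(x) = (exp(xT) a)_k` with `T` the shift by
two, and `exp(xT)` is invertible. The same invertibility gives `κ > 0`. -/

/-! ### Heat coefficients of a bounded sequence -/

/-- `∑_{u ≥ 0} a_{2u+k} x^u / u!`, the `k`-th coefficient of the heat flow at time `x` applied to
the exponential generating function of `a`. -/
noncomputable def heatCoeff (a : ℕ → ℝ) (k : ℕ) (x : ℝ) : ℝ :=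
  ∑' u : ℕ, a (2 * u + k) / (u.factorial : ℝ) * x ^ u

/-- `∑_k F_k(x) F_k(y) r^k / k!` where `F_k` is the `k`-th heat coefficient of `a`. -/
noncomputable def heatPairing (a : ℕ → ℝ) (x y r : ℝ) : ℝ :=
  ∑' k : ℕ, heatCoeff a k x * heatCoeff a k y * r ^ k / (k.factorial : ℝ)

theorem hasSum_mul_pow_div_factorial (M R : ℝ) :
    HasSum (fun k : ℕ => M * (R ^ k / (k.factorial : ℝ))) (M * Real.exp R) := by
  rw [Real.exp_eq_exp_ℝ]
  exact (NormedSpace.expSeries_div_hasSum_exp R).mul_left M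

theorem nonneg_of_bounded {a : ℕ → ℝ} {N : ℝ} (ha : ∀ n, |a n| ≤ N) : 0 ≤ N :=
  (abs_nonneg _).trans (ha 0)

theorem abs_heatCoeff_term_le {a : ℕ → ℝ} {N : ℝ} (ha : ∀ n, |a n| ≤ N) (k u : ℕ) (x : ℝ) :
    |a (2 * u + k) / (u.factorial : ℝ) * x ^ u| ≤ N * (|x| ^ u / (u.factorial : ℝ)) := by
  rw [abs_mul, abs_div, abs_pow, Nat.abs_cast, div_mul_eq_mul_div, mul_div_assoc]
  gcongr
  exact ha _

theorem hasSum_heatCoeff {a : ℕ → ℝ} {N : ℝ} (ha : ∀ n, |a n| ≤ N) (k : ℕ) (x : ℝ) :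
    HasSum (fun u : ℕ => a (2 * u + k) / (u.factorial : ℝ) * x ^ u) (heatCoeff a k x) :=
  (Summable.of_norm_bounded (hasSum_mul_pow_div_factorial N |x|).summable
    fun u => abs_heatCoeff_term_le ha k u x).hasSum

theorem abs_heatCoeff_le {a : ℕ → ℝ} {N : ℝ} (ha : ∀ n, |a n| ≤ N) (k : ℕ) (x : ℝ) :
    |heatCoeff a k x| ≤ N * Real.exp |x| := by
  rw [← Real.norm_eq_abs]
  exact tsum_of_norm_bounded (hasSum_mul_pow_div_factorial N |x|)
    fun u => abs_heatCoeff_term_le ha k u x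

theorem heatCoeff_even {a : ℕ → ℝ} (ha : ∀ n, a (2 * n) = 0) (k : ℕ) (x : ℝ) :
    heatCoeff a (2 * k) x = 0 := by
  have : ∀ u : ℕ, a (2 * u + 2 * k) = 0 := fun u => by rw [← mul_add]; exact ha _
  simp [heatCoeff, this]

/-! ### The heat flow as the exponential of a bounded operator -/

/-- The shift by two on bounded sequences. -/
noncomputable def shiftTwo :
    (BoundedContinuousFunction ℕ ℝ) →L[ℝ] (BoundedContinuousFunction ℕ ℝ) :=
  LinearMap.mkContinuous
    { toFun := fun g => g.compContinuous ⟨fun n => n + 2, continuous_of_discreteTopology⟩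
      map_add' := fun _ _ => rfl
      map_smul' := fun _ _ => rfl } 1 fun g => by
    rw [one_mul]
    exact (BoundedContinuousFunction.norm_le (norm_nonneg _)).2 fun n => g.norm_coe_le_norm (n + 2)

theorem shiftTwo_pow_apply (g : BoundedContinuousFunction ℕ ℝ) (u k : ℕ) :
    (shiftTwo ^ u) g k = g (2 * u + k) := by
  induction u generalizing k with
  | zero => simp
  | succ u ih =>
    rw [pow_succ', mul_apply_eq_comp]
    change (shiftTwo ^ u) g (k + 2) = _
    rw [ih]
    congr 1
    ring

theorem exp_neg_smul_mul_exp_smul {A : Type*} [NormedRing A] [NormedAlgebra ℝ A] [CompleteSpace A]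
    (T : A) (x : ℝ) : NormedSpace.exp ((-x) • T) * NormedSpace.exp (x • T) = 1 := by
  let : NormedAlgebra ℚ A := NormedAlgebra.restrictScalars ℚ ℝ A
  rw [← NormedSpace.exp_add_of_commute, ← add_smul]
  · simp
  · exact ((Commute.refl T).smul_left _).smul_right _

section ExpFlow

variable {E : Type*} [NormedAddCommGroup E] [NormedSpace ℝ E] [CompleteSpace E] (T : E →L[ℝ] E)

/-- The one-parameter group `x ↦ exp (x T)` generated by a bounded operator `T`. -/
noncomputable def expFlow (x : ℝ) : E →L[ℝ] E := NormedSpace.exp (x • T)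

theorem hasSum_expFlow_apply (x : ℝ) (v : E) :
    HasSum (fun u : ℕ => ((u.factorial : ℝ)⁻¹ * x ^ u) • (T ^ u) v) (expFlow T x v) := by
  have h := (ContinuousLinearMap.apply ℝ E v).hasSum
    (NormedSpace.exp_series_hasSum_exp' (𝕂 := ℝ) (x • T))
  simp only [smul_pow, smul_smul, map_smul, ContinuousLinearMap.apply_apply] at h
  exact h

theorem expFlow_neg_apply_expFlow_apply (x : ℝ) (v : E) :
    expFlow T (-x) (expFlow T x v) = v :=
  congrArg (fun S : E →L[ℝ] E => S v) (exp_neg_smul_mul_exp_smul T x)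

theorem hasDerivAt_expFlow_apply (x : ℝ) (v : E) :
    HasDerivAt (fun y => expFlow T y v) (expFlow T x (T v)) x :=
  (ContinuousLinearMap.apply ℝ E v).hasFDerivAt.comp_hasDerivAt x
    (hasDerivAt_exp_smul_const (𝕂 := ℝ) T x)

end ExpFlow

theorem expFlow_shiftTwo_apply (g : BoundedContinuousFunction ℕ ℝ) (k : ℕ) (x : ℝ) :
    expFlow shiftTwo x g k = heatCoeff g k x := by
  have h := (BoundedContinuousFunction.evalCLM ℝ k).hasSum (hasSum_expFlow_apply shiftTwo x g)
  refine h.tsum_eq.symm.trans (tsum_congr fun u => ?_)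
  simp only [map_smul, BoundedContinuousFunction.evalCLM_apply, shiftTwo_pow_apply, smul_eq_mul]
  ring

/-- A bounded sequence as a bounded continuous function. -/
noncomputable def boundedSeq {a : ℕ → ℝ} {N : ℝ} (ha : ∀ n, |a n| ≤ N) :
    BoundedContinuousFunction ℕ ℝ :=
  BoundedContinuousFunction.ofNormedAddCommGroupDiscrete a N ha

theorem boundedSeq_apply {a : ℕ → ℝ} {N : ℝ} (ha : ∀ n, |a n| ≤ N) (n : ℕ) :
    boundedSeq ha n = a n := rfl

theorem shiftTwo_apply (g : BoundedContinuousFunction ℕ ℝ) (k : ℕ) :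
    shiftTwo g k = g (k + 2) := rfl

theorem heatCoeff_eq_expFlow {a : ℕ → ℝ} {N : ℝ} (ha : ∀ n, |a n| ≤ N) (k : ℕ) (x : ℝ) :
    heatCoeff a k x = expFlow shiftTwo x (boundedSeq ha) k := by
  rw [expFlow_shiftTwo_apply]
  rfl

/-- The heat flow can be run backwards: `exp(-xT)` inverts `exp(xT)` on bounded sequences. -/
theorem eq_zero_of_heatCoeff_eq_zero {a : ℕ → ℝ} {N : ℝ} (ha : ∀ n, |a n| ≤ N) {x : ℝ}
    (h : ∀ k, heatCoeff a k x = 0) : a = 0 := by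
  have h1 : expFlow shiftTwo x (boundedSeq ha) = 0 := by
    ext k
    rw [← heatCoeff_eq_expFlow, h]
    rfl
  have h2 := expFlow_neg_apply_expFlow_apply shiftTwo x (boundedSeq ha)
  rw [h1, map_zero] at h2
  ext k
  exact (congrArg (fun g : BoundedContinuousFunction ℕ ℝ => g k) h2).symm

theorem hasDerivAt_heatCoeff {a : ℕ → ℝ} {N : ℝ} (ha : ∀ n, |a n| ≤ N) (k : ℕ) (x : ℝ) :
    HasDerivAt (heatCoeff a k) (heatCoeff a (k + 2) x) x := by
  have h := (BoundedContinuousFunction.evalCLM ℝ k).hasFDerivAt.comp_hasDerivAt x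
    (hasDerivAt_expFlow_apply shiftTwo x (boundedSeq ha))
  have e1 : heatCoeff a k = fun y => BoundedContinuousFunction.evalCLM ℝ k
      (expFlow shiftTwo y (boundedSeq ha)) := funext fun y => heatCoeff_eq_expFlow ha k y
  have e2 : heatCoeff a (k + 2) x = BoundedContinuousFunction.evalCLM ℝ k
      (expFlow shiftTwo x (shiftTwo (boundedSeq ha))) := by
    rw [BoundedContinuousFunction.evalCLM_apply, expFlow_shiftTwo_apply]
    refine tsum_congr fun u => ?_
    rw [shiftTwo_apply, boundedSeq_apply, add_assoc]
  rw [e1, e2]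
  exact h

/-! ### Estimates for heat coefficients and their pairing -/

theorem continuous_heatCoeff {a : ℕ → ℝ} {N : ℝ} (ha : ∀ n, |a n| ≤ N) (k : ℕ) :
    Continuous (heatCoeff a k) :=
  continuous_iff_continuousAt.2 fun x => (hasDerivAt_heatCoeff ha k x).continuousAt

theorem abs_heatCoeff_le_of_mem {a : ℕ → ℝ} {N R x : ℝ} (ha : ∀ n, |a n| ≤ N)
    (hx : x ∈ Set.Icc 0 R) (k : ℕ) : |heatCoeff a k x| ≤ N * Real.exp R := by
  refine (abs_heatCoeff_le ha k x).trans ?_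
  have := nonneg_of_bounded ha
  rw [abs_of_nonneg hx.1]
  gcongr
  exact hx.2

/-- Mean value inequality: the derivative is the coefficient of index `k + 2`, so the Lipschitz
constant is uniform in `k`. -/
theorem abs_heatCoeff_sub_le {a : ℕ → ℝ} {N R x y : ℝ} (ha : ∀ n, |a n| ≤ N)
    (hx : x ∈ Set.Icc 0 R) (hy : y ∈ Set.Icc 0 R) (k : ℕ) :
    |heatCoeff a k x - heatCoeff a k y| ≤ N * Real.exp R * |x - y| :=
  (convex_Icc 0 R).norm_image_sub_le_of_norm_hasDerivWithin_le
    (fun z _ => (hasDerivAt_heatCoeff ha k z).hasDerivWithinAt)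
    (fun _ hz => abs_heatCoeff_le_of_mem ha hz (k + 2)) hy hx

theorem abs_heatCoeff_mul_sub_le {a : ℕ → ℝ} {N R x y z η : ℝ} (ha : ∀ n, |a n| ≤ N)
    (hx : x ∈ Set.Icc 0 R) (hy : y ∈ Set.Icc 0 R) (hz : z ∈ Set.Icc 0 R)
    (hxz : |x - z| ≤ η) (hyz : |y - z| ≤ η) (k : ℕ) :
    |heatCoeff a k x * heatCoeff a k y - heatCoeff a k z ^ 2| ≤
      2 * (N * Real.exp R) ^ 2 * η := by
  have hM : 0 ≤ N * Real.exp R := mul_nonneg (nonneg_of_bounded ha) (Real.exp_pos _).le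
  have e : heatCoeff a k x * heatCoeff a k y - heatCoeff a k z ^ 2 =
      (heatCoeff a k x - heatCoeff a k z) * heatCoeff a k y +
        heatCoeff a k z * (heatCoeff a k y - heatCoeff a k z) := by ring
  have h1 := abs_heatCoeff_sub_le ha hx hz k
  have h2 := abs_heatCoeff_sub_le ha hy hz k
  have h3 := abs_heatCoeff_le_of_mem ha hy k
  have h4 := abs_heatCoeff_le_of_mem ha hz k
  set M := N * Real.exp R
  rw [e]
  calc _ ≤ |heatCoeff a k x - heatCoeff a k z| * |heatCoeff a k y| +
        |heatCoeff a k z| * |heatCoeff a k y - heatCoeff a k z| := by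
        rw [← abs_mul, ← abs_mul]; exact abs_add_le _ _
    _ ≤ M * η * M + M * (M * η) := by
        have h1' := h1.trans (mul_le_mul_of_nonneg_left hxz hM)
        have h2' := h2.trans (mul_le_mul_of_nonneg_left hyz hM)
        exact add_le_add (mul_le_mul h1' h3 (abs_nonneg _) ((abs_nonneg _).trans h1'))
          (mul_le_mul h4 h2' (abs_nonneg _) hM)
    _ = _ := by ring

theorem abs_heatPairing_term_le {a : ℕ → ℝ} {N R S x y r : ℝ} (ha : ∀ n, |a n| ≤ N)
    (hx : x ∈ Set.Icc 0 R) (hy : y ∈ Set.Icc 0 R) (hr : |r| ≤ S) (k : ℕ) :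
    |heatCoeff a k x * heatCoeff a k y * r ^ k / (k.factorial : ℝ)| ≤
      (N * Real.exp R) ^ 2 * (S ^ k / (k.factorial : ℝ)) := by
  have hM : 0 ≤ N * Real.exp R := mul_nonneg (nonneg_of_bounded ha) (Real.exp_pos _).le
  have hS : 0 ≤ S := (abs_nonneg r).trans hr
  rw [abs_div, abs_mul, abs_mul, abs_pow, Nat.abs_cast, mul_div_assoc, sq]
  gcongr
  · exact abs_heatCoeff_le_of_mem ha hx k
  · exact abs_heatCoeff_le_of_mem ha hy k

theorem hasSum_heatPairing {a : ℕ → ℝ} {N x y : ℝ} (ha : ∀ n, |a n| ≤ N)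
    (hx : 0 ≤ x) (hy : 0 ≤ y) (r : ℝ) :
    HasSum (fun k : ℕ => heatCoeff a k x * heatCoeff a k y * r ^ k / (k.factorial : ℝ))
      (heatPairing a x y r) :=
  (Summable.of_norm_bounded (hasSum_mul_pow_div_factorial _ |r|).summable
    fun k => abs_heatPairing_term_le ha (R := max x y) ⟨hx, le_max_left _ _⟩
      ⟨hy, le_max_right _ _⟩ le_rfl k).hasSum

theorem heatPairing_self_pos {a : ℕ → ℝ} {N x r : ℝ} (ha : ∀ n, |a n| ≤ N) (h0 : a ≠ 0)
    (hx : 0 ≤ x) (hr : 0 < r) : 0 < heatPairing a x x r := by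
  obtain ⟨k, hk⟩ : ∃ k, heatCoeff a k x ≠ 0 := by
    by_contra! h
    exact h0 (eq_zero_of_heatCoeff_eq_zero ha h)
  refine (hasSum_heatPairing ha hx hx r).summable.tsum_pos (fun i => ?_) k ?_
  · have := mul_self_nonneg (heatCoeff a i x)
    positivity
  · have := mul_self_pos.2 hk
    positivity

theorem continuousOn_heatPairing_self {a : ℕ → ℝ} {N : ℝ} (ha : ∀ n, |a n| ≤ N) (R r : ℝ) :
    ContinuousOn (fun x => heatPairing a x x r) (Set.Icc 0 R) := by
  refine continuousOn_tsum (fun k => ?_) (hasSum_mul_pow_div_factorial _ |r|).summable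
    fun k x hx => abs_heatPairing_term_le ha hx hx le_rfl k
  have := continuous_heatCoeff ha k
  fun_prop

/-- A continuous positive function has a positive minimum on a compact interval. -/
theorem exists_pos_le_heatPairing_self {a : ℕ → ℝ} {N r : ℝ} (ha : ∀ n, |a n| ≤ N) (h0 : a ≠ 0)
    (R : ℝ) (hr : 0 < r) : ∃ h > 0, ∀ x ∈ Set.Icc 0 R, h ≤ heatPairing a x x r := by
  rcases (Set.Icc 0 R).eq_empty_or_nonempty with he | hne
  · exact ⟨1, one_pos, by simp [he]⟩
  · obtain ⟨z, hz, hmin⟩ := isCompact_Icc.exists_isMinOn hne (continuousOn_heatPairing_self ha R r)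
    exact ⟨_, heatPairing_self_pos ha h0 hz.1 hr, fun x hx => hmin hx⟩

theorem abs_heatPairing_diag_sub_le {a : ℕ → ℝ} {N R t : ℝ} (ha : ∀ n, |a n| ≤ N) (hR : 1 ≤ R)
    (ht : t ∈ Set.Icc 0 R) :
    |heatPairing a (t / 2) (t / 2) t - heatPairing a (1 / 2) (1 / 2) 1| ≤
      2 * (N * Real.exp R) ^ 2 * |t - 1| * Real.exp (2 * R) := by
  have ht2 : t / 2 ∈ Set.Icc 0 R := ⟨by linarith [ht.1], by linarith [ht.1, ht.2]⟩
  have h12 : (1 / 2 : ℝ) ∈ Set.Icc 0 R := ⟨by norm_num, by linarith⟩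
  rw [← ((hasSum_heatPairing ha ht2.1 ht2.1 t).sub
    (hasSum_heatPairing ha h12.1 h12.1 1)).tsum_eq]
  rw [← Real.norm_eq_abs]
  refine tsum_of_norm_bounded (hasSum_mul_pow_div_factorial _ (2 * R)) fun k => ?_
  have h1 := abs_heatCoeff_mul_sub_le ha ht2 ht2 h12 (η := |t - 1|)
    (by rw [← sub_div, abs_div, abs_two]; linarith [abs_nonneg (t - 1)])
    (by rw [← sub_div, abs_div, abs_two]; linarith [abs_nonneg (t - 1)]) k
  have h2 := abs_heatCoeff_le_of_mem ha h12 k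
  set M := N * Real.exp R
  set p := heatCoeff a k (t / 2)
  set q := heatCoeff a k (1 / 2)
  have h3 : |t ^ k| ≤ R ^ k := by
    rw [abs_pow, abs_of_nonneg ht.1]
    exact pow_le_pow_left₀ ht.1 ht.2 k
  have h4 : |t ^ k - 1| ≤ |t - 1| * (k * R ^ k) := by
    have := abs_pow_sub_pow_le t 1 k
    rw [one_pow, mul_assoc] at this
    refine this.trans ?_
    gcongr
    refine (pow_le_pow_left₀ (by positivity) ?_ _).trans (pow_le_pow_right₀ hR (Nat.sub_le k 1))
    rw [abs_of_nonneg ht.1, abs_one]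
    exact max_le ht.2 hR
  have h5 : |q ^ 2| ≤ M ^ 2 := by
    rw [abs_pow]
    exact pow_le_pow_left₀ (abs_nonneg _) h2 2
  have hRk : 0 ≤ R ^ k := by positivity
  have e : p * p * t ^ k / (k.factorial : ℝ) - q * q * 1 ^ k / (k.factorial : ℝ) =
      ((p * p - q ^ 2) * t ^ k + q ^ 2 * (t ^ k - 1)) / (k.factorial : ℝ) := by
    rw [one_pow]; ring
  rw [e, Real.norm_eq_abs, abs_div, Nat.abs_cast, ← mul_div_assoc]
  gcongr
  -- The factor `k` from differentiating `t ^ k` is absorbed here, turning the majorant `exp R` into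
  -- `exp (2R)`.
  have hk : (2 + k : ℝ) ≤ 2 * 2 ^ k := by
    have : k + 1 ≤ 2 ^ k := Nat.lt_two_pow_self
    have : (k + 1 : ℝ) ≤ 2 ^ k := by exact_mod_cast this
    linarith [one_le_pow₀ (one_le_two : (1 : ℝ) ≤ 2) (n := k)]
  calc _ ≤ |p * p - q ^ 2| * |t ^ k| + |q ^ 2| * |t ^ k - 1| := by
        rw [← abs_mul, ← abs_mul]; exact abs_add_le _ _
    _ ≤ 2 * M ^ 2 * |t - 1| * R ^ k + M ^ 2 * (|t - 1| * (k * R ^ k)) := by gcongr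
    _ = M ^ 2 * |t - 1| * R ^ k * (2 + k) := by ring
    _ ≤ M ^ 2 * |t - 1| * R ^ k * (2 * 2 ^ k) := by gcongr
    _ = _ := by rw [mul_pow]; ring

/-- Even terms vanish. In the `k = 1` term the arguments move by `O(ε²)` and `r` supplies another
`ε`; the terms `k ≥ 3` carry `ε³` already. -/
theorem abs_heatPairing_sub_linear_le {a : ℕ → ℝ} {N R s t r ε : ℝ} (ha : ∀ n, |a n| ≤ N)
    (heven : ∀ n, a (2 * n) = 0) (hR : 1 ≤ R) (hεR : ε ≤ R) (hs : s ∈ Set.Icc 0 R)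
    (ht : t ∈ Set.Icc 0 R) (hs1 : |s - 1| ≤ ε ^ 2) (ht1 : |t - 1| ≤ ε ^ 2) (hr : |r| ≤ ε) :
    |heatPairing a (s / 2) (t / 2) r - heatCoeff a 1 (1 / 2) ^ 2 * r| ≤
      2 * (N * Real.exp R) ^ 2 * ε ^ 3 * Real.exp R := by
  have hε : 0 ≤ ε := (abs_nonneg r).trans hr
  have hs2 : s / 2 ∈ Set.Icc 0 R := ⟨by linarith [hs.1], by linarith [hs.1, hs.2]⟩
  have ht2 : t / 2 ∈ Set.Icc 0 R := ⟨by linarith [ht.1], by linarith [ht.1, ht.2]⟩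
  have h12 : (1 / 2 : ℝ) ∈ Set.Icc 0 R := ⟨by norm_num, by linarith⟩
  rw [← ((hasSum_heatPairing ha hs2.1 ht2.1 r).sub
    (hasSum_ite_eq 1 (heatCoeff a 1 (1 / 2) ^ 2 * r))).tsum_eq]
  rw [← Real.norm_eq_abs]
  refine tsum_of_norm_bounded (hasSum_mul_pow_div_factorial _ R) fun k => ?_
  rw [Real.norm_eq_abs]
  rcases Nat.even_or_odd' k with ⟨m, rfl | rfl⟩
  · rw [if_neg (by lia), heatCoeff_even heven, heatCoeff_even heven]
    simp only [zero_mul, zero_div, sub_zero, abs_zero]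
    positivity
  rcases m with _ | m
  · have h1 := abs_heatCoeff_mul_sub_le ha hs2 ht2 h12 (η := ε ^ 2)
      (by rw [← sub_div, abs_div, abs_two]; linarith [abs_nonneg (s - 1)])
      (by rw [← sub_div, abs_div, abs_two]; linarith [abs_nonneg (t - 1)]) 1
    simp only [mul_zero, zero_add, pow_one, Nat.factorial_one, Nat.cast_one, div_one, if_true]
    rw [← sub_mul, abs_mul]
    calc _ ≤ 2 * (N * Real.exp R) ^ 2 * ε ^ 2 * ε := by gcongr
      _ = 2 * (N * Real.exp R) ^ 2 * ε ^ 3 * 1 := by ring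
      _ ≤ _ := by gcongr
  · rw [if_neg (by lia), sub_zero]
    refine (abs_heatPairing_term_le ha hs2 ht2 hr _).trans ?_
    have h3 : ε ^ (2 * (m + 1) + 1) ≤ ε ^ 3 * R ^ (2 * (m + 1) + 1) := by
      calc ε ^ (2 * (m + 1) + 1) = ε ^ 3 * ε ^ (2 * m) := by rw [← pow_add]; congr 1; ring
        _ ≤ ε ^ 3 * R ^ (2 * m) := by gcongr
        _ ≤ _ := by gcongr; lia
    have : 0 ≤ (N * Real.exp R) ^ 2 * ε ^ 3 *
      (R ^ (2 * (m + 1) + 1) / ((2 * (m + 1) + 1).factorial : ℝ)) := by positivity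
    calc _ ≤ (N * Real.exp R) ^ 2 *
          (ε ^ 3 * R ^ (2 * (m + 1) + 1) / ((2 * (m + 1) + 1).factorial : ℝ)) := by gcongr
      _ = (N * Real.exp R) ^ 2 * ε ^ 3 *
          (R ^ (2 * (m + 1) + 1) / ((2 * (m + 1) + 1).factorial : ℝ)) := by ring
      _ ≤ _ := by linarith

/-! ### Double power series and the expansion of the Gaussian generating function -/

theorem eq_zero_of_hasSum_pow_mul_eq_zero {c : ℕ → ℝ}
    (h : ∀ s : ℝ, HasSum (fun m => s ^ m * c m) 0) : c = 0 := by
  have h1 : HasFPowerSeriesAt (fun _ : ℝ => (0 : ℝ)) (FormalMultilinearSeries.ofScalars ℝ c) 0 := by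
    rw [hasFPowerSeriesAt_iff]
    exact Filter.Eventually.of_forall fun s => by
      simpa [FormalMultilinearSeries.coeff_ofScalars] using h s
  have h2 := h1.eq_zero
  ext m
  rw [← FormalMultilinearSeries.coeff_ofScalars (𝕜 := ℝ) (p := c), h2]
  rfl

theorem eq_of_hasSum_pow_mul_pow {c d : ℕ × ℕ → ℝ} {g : ℝ → ℝ → ℝ}
    (hc : ∀ s t : ℝ, HasSum (fun p => c p * (s ^ p.1 * t ^ p.2)) (g s t))
    (hd : ∀ s t : ℝ, HasSum (fun p => d p * (s ^ p.1 * t ^ p.2)) (g s t)) : c = d := by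
  have he : ∀ s t : ℝ, HasSum (fun p => (c p - d p) * (s ^ p.1 * t ^ p.2)) 0 := fun s t => by
    simpa [sub_mul] using (hc s t).sub (hd s t)
  have hin : ∀ (t : ℝ) (m : ℕ), Summable fun n => t ^ n * (c (m, n) - d (m, n)) := fun t m => by
    have := (he 1 t).summable.prod_factor m
    refine this.congr fun n => ?_
    rw [one_pow, one_mul, mul_comm]
  have hz : ∀ (t : ℝ) (m : ℕ), ∑' n, t ^ n * (c (m, n) - d (m, n)) = 0 := fun t m => by
    have : (fun m => ∑' n, t ^ n * (c (m, n) - d (m, n))) = 0 := by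
      refine eq_zero_of_hasSum_pow_mul_eq_zero fun s => ?_
      refine (he s t).prod_fiberwise fun m => ?_
      refine ((hin t m).hasSum.mul_left (s ^ m)).congr_fun ?_
      intro n
      ring
    exact congrFun this m
  ext ⟨m, n⟩
  have : (fun n => c (m, n) - d (m, n)) = 0 :=
    eq_zero_of_hasSum_pow_mul_eq_zero fun t => by
      rw [← hz t m]
      exact (hin t m).hasSum
  exact sub_eq_zero.1 (congrFun this n)

theorem hasSum_pow_div_factorial_mul (x y : ℝ) :
    HasSum (fun p : ℕ × ℕ => x ^ p.1 / (p.1.factorial : ℝ) * (y ^ p.2 / (p.2.factorial : ℝ)))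
      (Real.exp x * Real.exp y) := by
  have h : ∀ z : ℝ, HasSum (fun n : ℕ => z ^ n / (n.factorial : ℝ)) (Real.exp z) := fun z => by
    rw [Real.exp_eq_exp_ℝ]
    exact NormedSpace.expSeries_div_hasSum_exp z
  have hs := summable_mul_of_summable_norm (R := ℝ) (h x).summable.norm (h y).summable.norm
  exact (h x).mul (h y) hs

/-- The general term of the expansion of `exp (x + y + r)`, indexed by `(k, u, v)`, with `r`, `x`
and `y` raised to the powers `k`, `u` and `v`. -/
noncomputable def expTerm (x y r : ℝ) (q : ℕ × ℕ × ℕ) : ℝ :=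
  r ^ q.1 / (q.1.factorial : ℝ) *
    (x ^ q.2.1 / (q.2.1.factorial : ℝ) * (y ^ q.2.2 / (q.2.2.factorial : ℝ)))

/-- The bidegree in `(s, t)` of the `(k, u, v)` term of `exp (s² x + t² y + s t r)`. -/
def bidegree (q : ℕ × ℕ × ℕ) : ℕ × ℕ := (2 * q.2.1 + q.1, 2 * q.2.2 + q.1)

theorem hasSum_expTerm (x y r : ℝ) :
    HasSum (expTerm x y r) (Real.exp r * (Real.exp x * Real.exp y)) := by
  have h1 := hasSum_mul_pow_div_factorial 1 r
  simp only [one_mul] at h1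
  have h2 := hasSum_pow_div_factorial_mul x y
  have hs := summable_mul_of_summable_norm (R := ℝ) h1.summable.norm h2.summable.norm
  exact h1.mul h2 hs

theorem abs_expTerm (x y r : ℝ) (q : ℕ × ℕ × ℕ) :
    |expTerm x y r q| = expTerm |x| |y| |r| q := by
  simp only [expTerm, abs_mul, abs_div, abs_pow, Nat.abs_cast]

theorem hasSum_mul_tsum_fiber_bidegree {x y r S : ℝ} {g : ℕ × ℕ → ℝ}
    (h : HasSum (fun q => g (bidegree q) * expTerm x y r q) S) :
    HasSum (fun p => g p * ∑' q : bidegree ⁻¹' {p}, expTerm x y r q) S := by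
  refine (h.tsum_fiberwise bidegree).congr_fun fun p => ?_
  rw [← tsum_mul_left]
  refine tsum_congr fun q => ?_
  rw [show bidegree q = p from q.2]

theorem hasSum_tsum_fiber_bidegree_mul_pow (x y r s t : ℝ) :
    HasSum (fun p : ℕ × ℕ => (∑' q : bidegree ⁻¹' {p}, expTerm x y r q) * (s ^ p.1 * t ^ p.2))
      (Real.exp (s * t * r + (s ^ 2 * x + t ^ 2 * y))) := by
  rw [Real.exp_add, Real.exp_add]
  refine (hasSum_mul_tsum_fiber_bidegree (g := fun p => s ^ p.1 * t ^ p.2) (x := x) (y := y)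
    (r := r) ((hasSum_expTerm _ _ _).congr_fun fun q => ?_)).congr_fun fun p => mul_comm _ _
  simp only [bidegree, expTerm, mul_pow, pow_add, pow_mul]
  ring

/-- The triple series converges absolutely; summing over `(u, v)` at fixed `k` factors into two heat
coefficients. -/
theorem hasSum_mul_expTerm {a : ℕ → ℝ} {N x y : ℝ} (ha : ∀ n, |a n| ≤ N) (hx : 0 ≤ x)
    (hy : 0 ≤ y) (r : ℝ) :
    HasSum (fun q => a (bidegree q).1 * a (bidegree q).2 * expTerm x y r q)
      (heatPairing a x y r) := by
  have hN := nonneg_of_bounded ha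
  have hs : Summable (fun q => a (bidegree q).1 * a (bidegree q).2 * expTerm x y r q) := by
    refine Summable.of_norm_bounded ((hasSum_expTerm |x| |y| |r|).summable.mul_left (N * N))
      fun q => ?_
    rw [Real.norm_eq_abs, abs_mul, abs_mul, abs_expTerm]
    have : 0 ≤ expTerm |x| |y| |r| q := by rw [← abs_expTerm]; exact abs_nonneg _
    gcongr
    · exact ha _
    · exact ha _
  have hin : ∀ k : ℕ, HasSum
      (fun uv : ℕ × ℕ => a (bidegree (k, uv)).1 * a (bidegree (k, uv)).2 * expTerm x y r (k, uv))
      (heatCoeff a k x * heatCoeff a k y * r ^ k / (k.factorial : ℝ)) := fun k => by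
    have h1 := hasSum_heatCoeff ha k x
    have h2 := hasSum_heatCoeff ha k y
    have h3 := summable_mul_of_summable_norm (R := ℝ) h1.summable.norm h2.summable.norm
    rw [mul_div_assoc]
    refine ((h1.mul h2 h3).mul_right (r ^ k / (k.factorial : ℝ))).congr_fun fun uv => ?_
    simp only [bidegree, expTerm]
    ring
  have h := hs.hasSum.prod_fiberwise hin
  exact (h.unique (hasSum_heatPairing ha hx hy r)) ▸ hs.hasSum

/-- Reduces integrability of the dominating function to exponential moments of linear combinations.
-/
theorem exp_abs_mul_exp_abs_le (x y : ℝ) : Real.exp |x| * Real.exp |y| ≤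
    Real.exp (x + y) + Real.exp (x + -y) + Real.exp (-x + y) + Real.exp (-x + -y) := by
  simp only [Real.exp_add]
  have h : ∀ z : ℝ, Real.exp |z| ≤ Real.exp z + Real.exp (-z) := fun z => by
    rcases abs_cases z with ⟨h, _⟩ | ⟨h, _⟩ <;> rw [h] <;>
      linarith [Real.exp_pos z, Real.exp_pos (-z)]
  calc _ ≤ (Real.exp x + Real.exp (-x)) * (Real.exp y + Real.exp (-y)) :=
        mul_le_mul (h x) (h y) (Real.exp_pos _).le (by positivity)
    _ = _ := by ring

/-! ### Mixed moments of a pair with Gaussian generating function -/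

section PairMoments

variable {Ω : Type*} [MeasurableSpace Ω] {μ : Measure Ω} {X Y : Ω → ℝ}

theorem hasSum_integral_pow_mul_pow {a b : ℕ → ℝ} {N M : ℝ} {f g : ℝ → ℝ}
    (ha : ∀ n, |a n| ≤ N) (hb : ∀ n, |b n| ≤ M)
    (hf : ∀ x, HasSum (fun n : ℕ => a n / (n.factorial : ℝ) * x ^ n) (f x))
    (hg : ∀ x, HasSum (fun n : ℕ => b n / (n.factorial : ℝ) * x ^ n) (g x))
    (hX : Measurable X) (hY : Measurable Y)
    (hint : Integrable (fun ω => Real.exp |X ω| * Real.exp |Y ω|) μ) :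
    HasSum (fun p : ℕ × ℕ => a p.1 * b p.2 *
        ((∫ ω, X ω ^ p.1 * Y ω ^ p.2 ∂μ) / ((p.1.factorial : ℝ) * (p.2.factorial : ℝ))))
      (∫ ω, f (X ω) * g (Y ω) ∂μ) := by
  have hN := nonneg_of_bounded ha
  have hM := nonneg_of_bounded hb
  have hbd : ∀ x y : ℝ, HasSum (fun p : ℕ × ℕ => N * M * (|x| ^ p.1 / (p.1.factorial : ℝ) *
      (|y| ^ p.2 / (p.2.factorial : ℝ)))) (N * M * (Real.exp |x| * Real.exp |y|)) := fun x y =>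
    (hasSum_pow_div_factorial_mul |x| |y|).mul_left _
  have hle : ∀ (x y : ℝ) (p : ℕ × ℕ), ‖a p.1 / (p.1.factorial : ℝ) * x ^ p.1 *
      (b p.2 / (p.2.factorial : ℝ) * y ^ p.2)‖ ≤ N * M * (|x| ^ p.1 / (p.1.factorial : ℝ) *
      (|y| ^ p.2 / (p.2.factorial : ℝ))) := fun x y p => by
    rw [Real.norm_eq_abs, abs_mul, abs_mul, abs_mul, abs_div, abs_div, abs_pow, abs_pow,
      Nat.abs_cast, Nat.abs_cast]
    calc _ ≤ N / (p.1.factorial : ℝ) * |x| ^ p.1 * (M / (p.2.factorial : ℝ) * |y| ^ p.2) := by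
          gcongr
          · exact ha _
          · exact hb _
      _ = _ := by ring
  have key := hasSum_integral_of_dominated_convergence (μ := μ)
    (F := fun (p : ℕ × ℕ) ω => a p.1 / (p.1.factorial : ℝ) * X ω ^ p.1 *
      (b p.2 / (p.2.factorial : ℝ) * Y ω ^ p.2)) (f := fun ω => f (X ω) * g (Y ω))
    (fun (p : ℕ × ℕ) ω => N * M * (|X ω| ^ p.1 / (p.1.factorial : ℝ) *
      (|Y ω| ^ p.2 / (p.2.factorial : ℝ))))
    (fun p => Measurable.aestronglyMeasurable (by fun_prop))
    (fun p => Filter.Eventually.of_forall fun ω => hle _ _ p)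
    (Filter.Eventually.of_forall fun ω => (hbd _ _).summable)
    (by simpa only [(hbd _ _).tsum_eq] using hint.const_mul (N * M))
    (Filter.Eventually.of_forall fun ω => (hf _).mul (hg _)
      (Summable.of_norm_bounded (hbd _ _).summable (hle _ _)))
  refine key.congr_fun ?_
  intro p
  rw [← integral_div, ← integral_const_mul]
  refine integral_congr_ae (Filter.Eventually.of_forall fun ω => ?_)
  simp only
  ring

theorem integrable_exp_abs_mul_exp_abs (hX : Measurable X) (hY : Measurable Y)
    (hint : ∀ s t : ℝ, Integrable (fun ω => Real.exp (s * X ω + t * Y ω)) μ) (s t : ℝ) :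
    Integrable (fun ω => Real.exp |s * X ω| * Real.exp |t * Y ω|) μ := by
  refine ((((hint s t).add (hint s (-t))).add (hint (-s) t)).add (hint (-s) (-t))).mono'
    (Measurable.aestronglyMeasurable (by fun_prop)) (Filter.Eventually.of_forall fun ω => ?_)
  rw [Real.norm_of_nonneg (by positivity)]
  simpa only [neg_mul, Pi.add_apply] using exp_abs_mul_exp_abs_le (s * X ω) (t * Y ω)

/-- Both sides are the coefficients of one double power series in `(s, t)`, the moment generating
function. -/
theorem integral_pow_mul_pow_div_factorial {x y r : ℝ} (hX : Measurable X) (hY : Measurable Y)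
    (hint : ∀ s t : ℝ, Integrable (fun ω => Real.exp (s * X ω + t * Y ω)) μ)
    (hmgf : ∀ s t : ℝ, ∫ ω, Real.exp (s * X ω + t * Y ω) ∂μ =
      Real.exp (s * t * r + (s ^ 2 * x + t ^ 2 * y))) (p : ℕ × ℕ) :
    (∫ ω, X ω ^ p.1 * Y ω ^ p.2 ∂μ) / ((p.1.factorial : ℝ) * (p.2.factorial : ℝ)) =
      ∑' q : bidegree ⁻¹' {p}, expTerm x y r q := by
  refine congrFun (eq_of_hasSum_pow_mul_pow
    (c := fun p : ℕ × ℕ => (∫ ω, X ω ^ p.1 * Y ω ^ p.2 ∂μ) /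
      ((p.1.factorial : ℝ) * (p.2.factorial : ℝ)))
    (d := fun p => ∑' q : bidegree ⁻¹' {p}, expTerm x y r q) (fun s t => ?_)
    (hasSum_tsum_fiber_bidegree_mul_pow x y r)) p
  -- The termwise integration is applied to `exp`, whose derivatives at `0` are all `1`, at `sX` and
  -- `tY`.
  have h1 : ∀ n : ℕ, |(fun _ : ℕ => (1 : ℝ)) n| ≤ 1 := by simp
  have hexp : ∀ z : ℝ, HasSum (fun n : ℕ => (1 : ℝ) / (n.factorial : ℝ) * z ^ n) (Real.exp z) :=
    fun z => by simpa [div_eq_inv_mul] using hasSum_mul_pow_div_factorial 1 z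
  have key := hasSum_integral_pow_mul_pow h1 h1 hexp hexp (hX.const_mul s) (hY.const_mul t)
    (integrable_exp_abs_mul_exp_abs hX hY hint s t)
  simp only [← Real.exp_add, hmgf] at key
  refine key.congr_fun fun p => ?_
  have : ∀ ω, s ^ p.1 * X ω ^ p.1 * (t ^ p.2 * Y ω ^ p.2) =
      (s ^ p.1 * t ^ p.2) * (X ω ^ p.1 * Y ω ^ p.2) := fun ω => by ring
  simp only [mul_pow, one_mul, this, integral_const_mul]
  ring

theorem integral_mul_eq_heatPairing {a : ℕ → ℝ} {N x y r : ℝ} {f : ℝ → ℝ}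
    (ha : ∀ n, |a n| ≤ N)
    (hf : ∀ z, HasSum (fun n : ℕ => a n / (n.factorial : ℝ) * z ^ n) (f z))
    (hx : 0 ≤ x) (hy : 0 ≤ y) (hX : Measurable X) (hY : Measurable Y)
    (hint : ∀ s t : ℝ, Integrable (fun ω => Real.exp (s * X ω + t * Y ω)) μ)
    (hmgf : ∀ s t : ℝ, ∫ ω, Real.exp (s * X ω + t * Y ω) ∂μ =
      Real.exp (s * t * r + (s ^ 2 * x + t ^ 2 * y))) :
    ∫ ω, f (X ω) * f (Y ω) ∂μ = heatPairing a x y r := by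
  have h1 := hasSum_integral_pow_mul_pow ha ha hf hf hX hY
    (by simpa only [one_mul] using integrable_exp_abs_mul_exp_abs hX hY hint 1 1)
  simp only [integral_pow_mul_pow_div_factorial hX hY hint hmgf] at h1
  exact h1.unique (hasSum_mul_tsum_fiber_bidegree (g := fun p => a p.1 * a p.2)
    (hasSum_mul_expTerm ha hx hy r))

end PairMoments

/-! ### Coordinates of a multivariate Gaussian -/

section Gaussian

variable {d : ℕ} {S : Matrix (Fin d) (Fin d) ℝ}

theorem map_linear_comb_multivariateGaussian (hS : S.PosSemidef) (i j : Fin d) (s t : ℝ) :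
    (multivariateGaussian 0 S).map (fun x => s * x i + t * x j) =
      gaussianReal 0 (s ^ 2 * S i i + 2 * (s * t * S i j) + t ^ 2 * S j j).toNNReal := by
  have hL : (fun x : EuclideanSpace ℝ (Fin d) => s * x i + t * x j) =
      ⇑(s • EuclideanSpace.proj (𝕜 := ℝ) i + t • EuclideanSpace.proj (𝕜 := ℝ) j :
        StrongDual ℝ (EuclideanSpace ℝ (Fin d))) := rfl
  have hm : ∀ k : Fin d, MemLp (fun x : EuclideanSpace ℝ (Fin d) => x k) 2
      (multivariateGaussian 0 S) := fun k =>
    IsGaussian.memLp_dual _ (EuclideanSpace.proj (𝕜 := ℝ) k) 2 (by simp)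
  have hv : Var[fun x : EuclideanSpace ℝ (Fin d) => s * x i + t * x j;
      multivariateGaussian 0 S] = s ^ 2 * S i i + 2 * (s * t * S i j) + t ^ 2 * S j j := by
    rw [variance_fun_add ((hm i).const_mul s) ((hm j).const_mul t), variance_const_mul,
      variance_const_mul, covariance_const_mul_left, covariance_const_mul_right,
      variance_eval_multivariateGaussian hS, variance_eval_multivariateGaussian hS,
      covariance_eval_multivariateGaussian hS]
    ring
  rw [← hv, hL, IsGaussian.map_eq_gaussianReal, ContinuousLinearMap.integral_comp_id_comm,
    integral_id_multivariateGaussian, map_zero]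
  exact IsGaussian.integrable_id

theorem quadratic_nonneg_of_posSemidef (hS : S.PosSemidef) (i j : Fin d) (s t : ℝ) :
    0 ≤ s ^ 2 * S i i + 2 * (s * t * S i j) + t ^ 2 * S j j := by
  have h := hS.dotProduct_mulVec_nonneg (Pi.single i s + Pi.single j t)
  have hij : S j i = S i j := hS.isHermitian.apply i j
  simp [Matrix.mulVec_add, add_dotProduct, dotProduct_add] at h
  rw [hij] at h
  linarith

theorem integrable_exp_linear_comb (hS : S.PosSemidef) (i j : Fin d) (s t : ℝ) :
    Integrable (fun x => Real.exp (s * x i + t * x j)) (multivariateGaussian 0 S) := by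
  have h := integrable_exp_mul_gaussianReal (μ := 0)
    (v := (s ^ 2 * S i i + 2 * (s * t * S i j) + t ^ 2 * S j j).toNNReal) 1
  rw [← map_linear_comb_multivariateGaussian hS, integrable_map_measure
    (by fun_prop) (by fun_prop)] at h
  simpa [Function.comp_def] using h

theorem integral_exp_linear_comb (hS : S.PosSemidef) (i j : Fin d) (s t : ℝ) :
    ∫ x, Real.exp (s * x i + t * x j) ∂(multivariateGaussian 0 S) =
      Real.exp (s * t * S i j + (s ^ 2 * (S i i / 2) + t ^ 2 * (S j j / 2))) := by
  have h := mgf_gaussianReal (map_linear_comb_multivariateGaussian hS i j s t) 1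
  simp only [mgf, one_mul] at h
  rw [h, Real.coe_toNNReal _ (quadratic_nonneg_of_posSemidef hS i j s t)]
  congr 1
  ring

theorem measurable_of_hasSum_taylor {a : ℕ → ℝ} {f : ℝ → ℝ}
    (hf : ∀ z, HasSum (fun n : ℕ => a n / (n.factorial : ℝ) * z ^ n) (f z)) : Measurable f := by
  refine measurable_of_tendsto_metrizable
    (f := fun m z => ∑ n ∈ Finset.range m, a n / (n.factorial : ℝ) * z ^ n)
    (fun m => by fun_prop) (tendsto_pi_nhds.2 fun z => (hf z).tendsto_sum_nat)

theorem abs_le_exp_abs_of_hasSum_taylor {a : ℕ → ℝ} {N : ℝ} {f : ℝ → ℝ} (ha : ∀ n, |a n| ≤ N)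
    (hf : ∀ z, HasSum (fun n : ℕ => a n / (n.factorial : ℝ) * z ^ n) (f z)) (z : ℝ) :
    |f z| ≤ N * Real.exp |z| := by
  rw [← (hf z).tsum_eq, ← Real.norm_eq_abs]
  refine tsum_of_norm_bounded (hasSum_mul_pow_div_factorial N |z|) fun n => ?_
  rw [Real.norm_eq_abs, abs_mul, abs_div, abs_pow, Nat.abs_cast, div_mul_eq_mul_div,
    mul_div_assoc]
  gcongr
  exact ha n

theorem memLp_two_comp_eval {a : ℕ → ℝ} {N : ℝ} {f : ℝ → ℝ} (ha : ∀ n, |a n| ≤ N)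
    (hf : ∀ z, HasSum (fun n : ℕ => a n / (n.factorial : ℝ) * z ^ n) (f z))
    (hS : S.PosSemidef) (i : Fin d) :
    MemLp (fun x => f (x i)) 2 (multivariateGaussian 0 S) := by
  have hm := measurable_of_hasSum_taylor hf
  have hN := nonneg_of_bounded ha
  rw [memLp_two_iff_integrable_sq (Measurable.aestronglyMeasurable (by fun_prop))]
  have hint := (integrable_exp_abs_mul_exp_abs (X := fun x : EuclideanSpace ℝ (Fin d) => x i)
    (Y := fun x : EuclideanSpace ℝ (Fin d) => x i) (by fun_prop) (by fun_prop)
    (integrable_exp_linear_comb hS i i) 1 1).const_mul (N * N)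
  simp only [one_mul] at hint
  refine hint.mono' (Measurable.aestronglyMeasurable (by fun_prop))
    (Filter.Eventually.of_forall fun x => ?_)
  have h := abs_le_exp_abs_of_hasSum_taylor ha hf (x i)
  rw [Real.norm_eq_abs, abs_pow, sq]
  calc _ ≤ N * Real.exp |x i| * (N * Real.exp |x i|) :=
        mul_le_mul h h (abs_nonneg _) (by positivity)
    _ = _ := by ring

/-- The centred one-dimensional law is invariant under negation, so the integral equals its own
negative. -/
theorem integral_odd_comp_eval {f : ℝ → ℝ} (hodd : Function.Odd f) (hm : Measurable f)
    (hS : S.PosSemidef) (i : Fin d) : ∫ x, f (x i) ∂(multivariateGaussian 0 S) = 0 := by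
  have hmap : (multivariateGaussian 0 S).map (fun x => x i) =
      gaussianReal 0 (S i i).toNNReal :=
    (measurePreserving_eval_multivariateGaussian (μ := 0) hS (i := i)).map_eq
  generalize (S i i).toNNReal = v at hmap
  have hneg : (gaussianReal 0 v).map (fun x => -x) = gaussianReal 0 v := by
    rw [gaussianReal_map_neg, neg_zero]
  have h1 : ∫ x, f (x i) ∂(multivariateGaussian 0 S) = ∫ z, f z ∂(gaussianReal 0 v) := by
    rw [← hmap, integral_map (by fun_prop) hm.aestronglyMeasurable]
  have h2 : ∫ z, f z ∂(gaussianReal 0 v) = -∫ z, f z ∂(gaussianReal 0 v) := by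
    conv_lhs => rw [← hneg]
    rw [integral_map (by fun_prop) hm.aestronglyMeasurable, ← integral_neg]
    simp only [hodd _]
  rw [h1]
  linarith

theorem covariance_comp_eval {a : ℕ → ℝ} {N : ℝ} {f : ℝ → ℝ} (hodd : Function.Odd f)
    (ha : ∀ n, |a n| ≤ N)
    (hf : ∀ z, HasSum (fun n : ℕ => a n / (n.factorial : ℝ) * z ^ n) (f z))
    (hS : S.PosSemidef) (i j : Fin d) :
    cov[fun x => f (x i), fun x => f (x j); multivariateGaussian 0 S] =
      heatPairing a (S i i / 2) (S j j / 2) (S i j) := by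
  have hm := measurable_of_hasSum_taylor hf
  rw [covariance_eq_sub (memLp_two_comp_eval ha hf hS i) (memLp_two_comp_eval ha hf hS j),
    integral_odd_comp_eval hodd hm hS, zero_mul, sub_zero]
  exact integral_mul_eq_heatPairing ha hf (div_nonneg hS.diag_nonneg two_pos.le)
    (div_nonneg hS.diag_nonneg two_pos.le) (by fun_prop) (by fun_prop)
    (integrable_exp_linear_comb hS i j) (integral_exp_linear_comb hS i j)

end Gaussian

/-! ### Euclidean operator norm bounds -/

section MatrixNorm

open Matrix

theorem abs_dotProduct_le {n : Type*} [Fintype n] (x y : n → ℝ) :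
    |x ⬝ᵥ y| ≤ ‖WithLp.toLp 2 x‖ * ‖WithLp.toLp 2 y‖ := by
  have h := abs_real_inner_le_norm (WithLp.toLp 2 y) (WithLp.toLp 2 x)
  rw [EuclideanSpace.inner_toLp_toLp, star_trivial, mul_comm] at h
  exact h

theorem norm_toLp_sq {n : Type*} [Fintype n] (x : n → ℝ) : ‖WithLp.toLp 2 x‖ ^ 2 = x ⬝ᵥ x := by
  rw [← real_inner_self_eq_norm_sq, EuclideanSpace.inner_toLp_toLp, star_trivial]

variable {n : Type*} [Fintype n] [DecidableEq n]

theorem norm_toLp_mulVec_le (A : Matrix n n ℝ) (x : n → ℝ) :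
    ‖WithLp.toLp 2 (A *ᵥ x)‖ ≤ ‖A‖ * ‖WithLp.toLp 2 x‖ :=
  A.l2_opNorm_mulVec (WithLp.toLp 2 x)

theorem l2_opNorm_le_of_norm_mulVec_le {A : Matrix n n ℝ} {c : ℝ} (hc : 0 ≤ c)
    (h : ∀ x : n → ℝ, ‖WithLp.toLp 2 (A *ᵥ x)‖ ≤ c * ‖WithLp.toLp 2 x‖) : ‖A‖ ≤ c := by
  rw [← l2_opNorm_toEuclideanCLM]
  exact ContinuousLinearMap.opNorm_le_bound _ hc fun x => h x.ofLp

theorem abs_dotProduct_mulVec_le (A : Matrix n n ℝ) (x : n → ℝ) :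
    |x ⬝ᵥ A *ᵥ x| ≤ ‖A‖ * (x ⬝ᵥ x) := by
  refine (abs_dotProduct_le x _).trans ?_
  have h := mul_le_mul_of_nonneg_left (norm_toLp_mulVec_le A x) (norm_nonneg (WithLp.toLp 2 x))
  refine h.trans_eq ?_
  rw [← norm_toLp_sq]
  ring

theorem abs_apply_le_l2_opNorm (A : Matrix n n ℝ) (i j : n) : |A i j| ≤ ‖A‖ := by
  set e : n → ℝ := Pi.single j 1 with he
  have h := norm_toLp_mulVec_le A e
  have h1 : ‖WithLp.toLp 2 e‖ = 1 := by simp [he]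
  rw [h1, mul_one] at h
  have h2 := PiLp.norm_apply_le (WithLp.toLp 2 (A *ᵥ e)) i
  refine le_trans ?_ h
  simpa [he] using h2

theorem posDef_one_add_of_l2_opNorm_lt_one {B : Matrix n n ℝ} (hB : B.IsSymm) (h : ‖B‖ < 1) :
    (1 + B).PosDef := by
  refine PosDef.of_dotProduct_mulVec_pos ?_ fun {x} hx => ?_
  · rw [IsHermitian, conjTranspose_eq_transpose_of_trivial, transpose_add, transpose_one, hB.eq]
  · have h0 : 0 < x ⬝ᵥ x := by
      rw [← norm_toLp_sq]
      have : WithLp.toLp 2 x ≠ 0 := fun h => hx (by simpa using h)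
      positivity
    have h1 := abs_dotProduct_mulVec_le B x
    rw [star_trivial, add_mulVec, one_mulVec, dotProduct_add]
    nlinarith [neg_abs_le (x ⬝ᵥ B *ᵥ x)]

theorem posSemidef_one_sub_of_l2_opNorm_le_one {B : Matrix n n ℝ} (hB : B.IsSymm) (h : ‖B‖ ≤ 1) :
    (1 - B).PosSemidef := by
  refine PosSemidef.of_dotProduct_mulVec_nonneg ?_ fun x => ?_
  · rw [IsHermitian, conjTranspose_eq_transpose_of_trivial, transpose_sub, transpose_one, hB.eq]
  · have h0 : 0 ≤ x ⬝ᵥ x := by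
      rw [← norm_toLp_sq]
      positivity
    have h1 := abs_dotProduct_mulVec_le B x
    rw [star_trivial, sub_mulVec, one_mulVec, dotProduct_sub]
    nlinarith [le_abs_self (x ⬝ᵥ B *ᵥ x)]

theorem l2_opNorm_one_le : ‖(1 : Matrix n n ℝ)‖ ≤ 1 :=
  l2_opNorm_le_of_norm_mulVec_le zero_le_one fun x => by rw [one_mulVec, one_mul]

theorem l2_opNorm_le_card_mul {A : Matrix n n ℝ} {c : ℝ} (hc : 0 ≤ c)
    (h : ∀ i j, |A i j| ≤ c) : ‖A‖ ≤ Fintype.card n * c := by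
  refine l2_opNorm_le_of_norm_mulVec_le (by positivity) fun x => ?_
  refine (sq_le_sq₀ (norm_nonneg _) (by positivity)).1 ?_
  have hrow : ∀ i, (A *ᵥ x) i ^ 2 ≤ Fintype.card n * c ^ 2 * (x ⬝ᵥ x) := fun i => by
    have h1 := Finset.sum_mul_sq_le_sq_mul_sq Finset.univ (fun j => A i j) x
    have h2 : ∑ j, A i j ^ 2 ≤ Fintype.card n * c ^ 2 := by
      refine (Finset.sum_le_card_nsmul _ _ (c ^ 2) fun j _ => ?_).trans_eq (by simp)
      rw [← sq_abs]
      exact pow_le_pow_left₀ (abs_nonneg _) (h i j) 2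
    have h3 : ∑ j, x j ^ 2 = x ⬝ᵥ x := by simp [dotProduct, sq]
    rw [h3] at h1
    refine h1.trans (mul_le_mul_of_nonneg_right h2 ?_)
    rw [← norm_toLp_sq]
    positivity
  rw [mul_pow, norm_toLp_sq, norm_toLp_sq]
  calc (A *ᵥ x) ⬝ᵥ (A *ᵥ x) = ∑ i, (A *ᵥ x) i ^ 2 := by simp [dotProduct, sq]
    _ ≤ ∑ _i : n, Fintype.card n * c ^ 2 * (x ⬝ᵥ x) := Finset.sum_le_sum fun i _ => hrow i
    _ = _ := by
      rw [Finset.sum_const, nsmul_eq_mul, Finset.card_univ]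
      ring

/-- Splitting off the diagonal confines the dimension factor to the off-diagonal entries. -/
theorem l2_opNorm_le_of_diag_of_offDiag {A : Matrix n n ℝ} {b c : ℝ} (hb : 0 ≤ b) (hc : 0 ≤ c)
    (hdiag : ∀ i, |A i i| ≤ b) (hoff : ∀ i j, i ≠ j → |A i j| ≤ c) :
    ‖A‖ ≤ b + Fintype.card n * c := by
  have h1 : ‖(diagonal fun i => A i i : Matrix n n ℝ)‖ ≤ b := by
    rw [l2_opNorm_diagonal]
    exact (pi_norm_le_iff_of_nonneg hb).2 hdiag
  have h2 : ‖A - diagonal fun i => A i i‖ ≤ Fintype.card n * c := by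
    refine l2_opNorm_le_card_mul hc fun i j => ?_
    rcases eq_or_ne i j with rfl | hij
    · simpa using hc
    · simpa [diagonal_apply_ne _ hij] using hoff i j hij
  calc ‖A‖ = ‖(diagonal fun i => A i i) + (A - diagonal fun i => A i i)‖ := by
        rw [add_sub_cancel]
    _ ≤ _ := (norm_add_le _ _).trans (add_le_add h1 h2)

theorem isUnit_of_le_dotProduct_mulVec {A : Matrix n n ℝ} {h : ℝ} (hh : 0 < h)
    (hA : ∀ x : n → ℝ, h * (x ⬝ᵥ x) ≤ x ⬝ᵥ A *ᵥ x) : IsUnit A := by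
  rw [← mulVec_injective_iff_isUnit]
  refine (injective_iff_map_eq_zero A.mulVecLin).2 fun x hx => ?_
  have h1 := hA x
  rw [← mulVecLin_apply, hx, dotProduct_zero, ← norm_toLp_sq] at h1
  have h2 : ‖WithLp.toLp 2 x‖ ^ 2 ≤ 0 := by nlinarith
  have h3 : ‖WithLp.toLp 2 x‖ = 0 := by nlinarith [norm_nonneg (WithLp.toLp 2 x)]
  simpa using h3

/-- Put `x = A⁻¹ y` in the form bound: `h ‖x‖² ≤ x ⬝ y ≤ ‖x‖ ‖y‖`. -/
theorem l2_opNorm_inv_le_of_le_dotProduct_mulVec {A : Matrix n n ℝ} {h : ℝ} (hh : 0 < h)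
    (hA : ∀ x : n → ℝ, h * (x ⬝ᵥ x) ≤ x ⬝ᵥ A *ᵥ x) : ‖A⁻¹‖ ≤ h⁻¹ := by
  have hu := isUnit_of_le_dotProduct_mulVec hh hA
  refine l2_opNorm_le_of_norm_mulVec_le (inv_nonneg.2 hh.le) fun y => ?_
  have h1 := hA (A⁻¹ *ᵥ y)
  rw [mulVec_mulVec, mul_nonsing_inv _ ((isUnit_iff_isUnit_det A).1 hu), one_mulVec,
    ← norm_toLp_sq] at h1
  have h2 := (le_abs_self _).trans (abs_dotProduct_le (A⁻¹ *ᵥ y) y)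
  rw [inv_mul_eq_div, le_div_iff₀ hh]
  rcases (norm_nonneg (WithLp.toLp 2 (A⁻¹ *ᵥ y))).eq_or_lt' with h0 | h0
  · rw [h0, zero_mul]
    positivity
  · refine le_of_mul_le_mul_left ?_ h0
    linarith

end MatrixNorm

/-! ### The inverse of `1 + B` and its entrywise powers -/

section Precision

open Matrix

variable {n : Type*} [Fintype n] [DecidableEq n] {B : Matrix n n ℝ} {δ : ℝ}

theorem one_add_mul_inv_cancel (hB : B.IsSymm) (h : ‖B‖ < 1) : (1 + B) * (1 + B)⁻¹ = 1 :=
  mul_nonsing_inv _ ((isUnit_iff_isUnit_det _).1 (posDef_one_add_of_l2_opNorm_lt_one hB h).isUnit)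

theorem inv_one_add_eq (hB : B.IsSymm) (h : ‖B‖ < 1) :
    (1 + B)⁻¹ = 1 - B * (1 + B)⁻¹ := by
  have := one_add_mul_inv_cancel hB h
  rw [add_mul, one_mul] at this
  exact eq_sub_of_add_eq this

theorem l2_opNorm_inv_one_add_le (h : ‖B‖ ≤ δ) (hδ : δ < 1) :
    ‖(1 + B)⁻¹‖ ≤ (1 - δ)⁻¹ := by
  have h0 : 0 < 1 - δ := by linarith
  refine l2_opNorm_inv_le_of_le_dotProduct_mulVec h0 fun x => ?_
  have h1 := neg_abs_le (x ⬝ᵥ B *ᵥ x)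
  have h2 := abs_dotProduct_mulVec_le B x
  have h3 : 0 ≤ x ⬝ᵥ x := by
    rw [← norm_toLp_sq]
    positivity
  have h4 := mul_le_mul_of_nonneg_right h h3
  rw [add_mulVec, one_mulVec, dotProduct_add]
  linarith

theorem l2_opNorm_inv_one_add_sub_one_le (hB : B.IsSymm) (h : ‖B‖ ≤ δ) (hδ : δ < 1) :
    ‖(1 + B)⁻¹ - 1‖ ≤ δ / (1 - δ) := by
  have h1 := inv_one_add_eq hB (h.trans_lt hδ)
  have h2 := l2_opNorm_inv_one_add_le h hδ
  have e : (1 + B)⁻¹ - 1 = -(B * (1 + B)⁻¹) := by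
    nth_rewrite 1 [h1]
    abel
  rw [e, norm_neg, div_eq_mul_inv]
  exact (l2_opNorm_mul _ _).trans
    (mul_le_mul h h2 (norm_nonneg _) ((norm_nonneg _).trans h))

/-- With `S = (1 + B)⁻¹`, the identity `S = 1 - B S` gives `S - 1 + B = -B (S - 1)`, a product of
two factors of norm at most `δ / (1 - δ)`. -/
theorem l2_opNorm_inv_one_add_sub_one_add_le (hB : B.IsSymm) (h : ‖B‖ ≤ δ) (hδ : δ < 1) :
    ‖(1 + B)⁻¹ - 1 + B‖ ≤ (δ / (1 - δ)) ^ 2 := by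
  have h2 := l2_opNorm_inv_one_add_sub_one_le hB h hδ
  have h0 := (norm_nonneg _).trans h
  have e : (1 + B)⁻¹ - 1 + B = -(B * ((1 + B)⁻¹ - 1)) := by
    nth_rewrite 1 [inv_one_add_eq hB (h.trans_lt hδ)]
    rw [mul_sub, mul_one]
    abel
  have h3 : δ ≤ δ / (1 - δ) := le_div_self h0 (by linarith) (by linarith)
  rw [e, norm_neg, sq]
  exact (l2_opNorm_mul _ _).trans
    (mul_le_mul (h.trans h3) h2 (norm_nonneg _) (h0.trans h3))

/-- With `S = (1 + B)⁻¹`, one has `S - 1/2 = (1/2) S (1 - B²) S`, and `1 - B² ≥ 0`. -/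
theorem posSemidef_inv_one_add_sub_half (hB : B.IsSymm) (h : ‖B‖ < 1) :
    ((1 + B)⁻¹ - (1 / 2 : ℝ) • 1).PosSemidef := by
  have hS := (posDef_one_add_of_l2_opNorm_lt_one hB h).inv
  have hc := one_add_mul_inv_cancel hB h
  have hc' : (1 + B)⁻¹ * (1 + B) = 1 := by rw [mul_eq_one_comm, hc]
  have hP : (1 - B * B).PosSemidef := by
    refine posSemidef_one_sub_of_l2_opNorm_le_one ?_ ?_
    · rw [IsSymm, transpose_mul, hB.eq]
    · exact (l2_opNorm_mul _ _).trans (mul_le_one₀ h.le (norm_nonneg _) h.le)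
  have h1 := (hP.mul_mul_conjTranspose_same (1 + B)⁻¹).smul (a := (1 / 2 : ℝ)) (by norm_num)
  have e : (1 + B)⁻¹ - (1 / 2 : ℝ) • 1 =
      (1 / 2 : ℝ) • ((1 + B)⁻¹ * (1 - B * B) * (1 + B)⁻¹ᴴ) := by
    rw [hS.isHermitian.eq]
    have e1 : (1 - B * B : Matrix n n ℝ) = (1 + B) * ((2 : ℝ) • 1 - (1 + B)) := by
      rw [two_smul]
      noncomm_ring
    rw [e1, ← mul_assoc, hc', one_mul, sub_mul, hc, smul_mul_assoc, one_mul, smul_sub, smul_smul]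
    norm_num
  rw [e]
  exact h1

/-- The entrywise power of a matrix. -/
def hadamardPow {n : Type*} (A : Matrix n n ℝ) (k : ℕ) : Matrix n n ℝ := A.map (· ^ k)

theorem hadamardPow_succ {n : Type*} (A : Matrix n n ℝ) (k : ℕ) :
    hadamardPow A (k + 1) = (hadamardPow A k).hadamard A := by
  ext i j
  exact pow_succ _ _

/-- Induction with the Schur product theorem. The power `0` is excluded: it is the all-ones matrix,
which does not dominate the identity in general. -/
theorem posSemidef_hadamardPow_sub {n : Type*} [DecidableEq n] {A : Matrix n n ℝ} {c : ℝ}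
    (hc : 0 ≤ c)
    (hA : (A - c • 1).PosSemidef) {k : ℕ} (hk : k ≠ 0) :
    (hadamardPow A k - c ^ k • 1).PosSemidef := by
  obtain ⟨k, rfl⟩ := Nat.exists_eq_succ_of_ne_zero hk
  have h1 : ∀ m : ℕ, (c ^ m • (1 : Matrix n n ℝ)).PosSemidef := fun m =>
    PosSemidef.one.smul (pow_nonneg hc m)
  induction k with
  | zero =>
    rw [pow_one]
    convert hA using 2
    ext i j
    simp [hadamardPow]
  | succ k ih =>
    have ih := ih (by simp)
    have hA' : A.PosSemidef := by simpa using hA.add (h1 1)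
    have e : hadamardPow A (k + 1).succ - c ^ (k + 1).succ • 1 =
        (hadamardPow A (k + 1) - c ^ (k + 1) • 1).hadamard A +
          (c ^ (k + 1) • (1 : Matrix n n ℝ)).hadamard (A - c • 1) := by
      rw [Nat.succ_eq_add_one (k + 1), hadamardPow_succ]
      ext i j
      rcases eq_or_ne i j with rfl | hij
      · simp; ring
      · simp [hij]
    rw [e]
    exact (ih.hadamard hA').add ((h1 _).hadamard hA)

theorem le_sum_hadamardPow {A : Matrix n n ℝ} {c : ℝ} (hc : 0 ≤ c)
    (hA : (A - c • 1).PosSemidef) {k : ℕ} (hk : k ≠ 0) (x : n → ℝ) :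
    c ^ k * ∑ i, x i ^ 2 ≤ ∑ i, ∑ j, x i * x j * A i j ^ k := by
  have h := (posSemidef_hadamardPow_sub hc hA hk).dotProduct_mulVec_nonneg x
  rw [star_trivial, sub_mulVec, dotProduct_sub, smul_mulVec, one_mulVec, dotProduct_smul,
    sub_nonneg, smul_eq_mul] at h
  have e1 : x ⬝ᵥ x = ∑ i, x i ^ 2 := by simp [dotProduct, sq]
  have e2 : x ⬝ᵥ hadamardPow A k *ᵥ x = ∑ i, ∑ j, x i * x j * A i j ^ k := by
    simp only [dotProduct, mulVec, hadamardPow, map_apply, Finset.mul_sum]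
    refine Finset.sum_congr rfl fun i _ => Finset.sum_congr rfl fun j _ => ?_
    ring
  rwa [e1, e2] at h

end Precision

/-! ### Taylor coefficients of an odd function -/

theorem iteratedDeriv_two_mul_zero_of_odd {f : ℝ → ℝ} (hodd : Function.Odd f) (n : ℕ) :
    iteratedDeriv (2 * n) f 0 = 0 := by
  have h1 := iteratedDeriv_comp_neg (2 * n) f 0
  have h2 : (fun x => f (-x)) = -f := funext hodd
  rw [h2, iteratedDeriv_neg, neg_zero, pow_mul] at h1
  simp at h1
  linarith

theorem iteratedDeriv_zero_ne_zero {f : ℝ → ℝ}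
    (htaylor : ∀ x : ℝ,
      HasSum (fun n : ℕ => iteratedDeriv n f 0 / (n.factorial : ℝ) * x ^ n) (f x))
    (hf : f ≠ 0) : (fun n => iteratedDeriv n f 0) ≠ 0 := fun h => hf <| by
  ext x
  have h1 := htaylor x
  simp only [fun n => show iteratedDeriv n f 0 = 0 from congrFun h n, zero_div, zero_mul] at h1
  exact h1.unique hasSum_zero

theorem tsum_odd_eq_of_hasSum {g : ℕ → ℝ} {S : ℝ} (hg : HasSum g S) (heven : ∀ k, g (2 * k) = 0) :
    ∑' k : ℕ, g (2 * k + 1) = S := by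
  have h0 : HasSum (fun k : ℕ => g (2 * k)) 0 := by
    simp only [heven]
    exact hasSum_zero
  have hs : Summable fun k : ℕ => g (2 * k + 1) :=
    hg.summable.comp_injective (i := fun k : ℕ => 2 * k + 1) fun x y hxy => by simpa using hxy
  have h1 := (h0.even_add_odd hs.hasSum).unique hg
  rwa [zero_add] at h1

theorem kappa_eq_heatPairing {f : ℝ → ℝ} (hodd : Function.Odd f) {N : ℝ}
    (ha : ∀ n : ℕ, |iteratedDeriv n f 0| ≤ N) :
    kappa f = heatPairing (fun n => iteratedDeriv n f 0) (1 / 2) (1 / 2) 1 := by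
  have h := hasSum_heatPairing ha (x := 1 / 2) (y := 1 / 2) (by norm_num) (by norm_num) 1
  rw [← tsum_odd_eq_of_hasSum h fun k => by
    rw [heatCoeff_even (iteratedDeriv_two_mul_zero_of_odd hodd), zero_mul, zero_mul, zero_div]]
  refine tsum_congr fun s => ?_
  rw [one_pow, mul_one, ← sq]
  rfl

/-! ### The covariance matrix: lower bound, expansion and inverse -/

section Covariance

open Matrix

variable {a : ℕ → ℝ} {N : ℝ}

/-- The covariance matrix of an odd function of the coordinates of a centred Gaussian vector with
covariance `S`, in terms of the Taylor coefficients `a` of the function. -/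
noncomputable def heatMatrix {n : Type*} (a : ℕ → ℝ) (S : Matrix n n ℝ) : Matrix n n ℝ :=
  Matrix.of fun i j => heatPairing a (S i i / 2) (S j j / 2) (S i j)

theorem le_dotProduct_heatMatrix_mulVec {n : Type*} [Fintype n] [DecidableEq n]
    {S : Matrix n n ℝ} {R c h : ℝ} (ha : ∀ n, |a n| ≤ N)
    (heven : ∀ n, a (2 * n) = 0) (hc : 0 ≤ c) (hS : (S - c • 1).PosSemidef)
    (hdiag : ∀ i, S i i / 2 ∈ Set.Icc 0 R)
    (hh : ∀ x ∈ Set.Icc 0 R, h ≤ heatPairing a x x c) (x : n → ℝ) :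
    h * (x ⬝ᵥ x) ≤ x ⬝ᵥ heatMatrix a S *ᵥ x := by
  have h1 : HasSum (fun k : ℕ => ∑ i, ∑ j, x i * x j *
      (heatCoeff a k (S i i / 2) * heatCoeff a k (S j j / 2) * S i j ^ k / (k.factorial : ℝ)))
      (∑ i, ∑ j, x i * x j * heatPairing a (S i i / 2) (S j j / 2) (S i j)) :=
    hasSum_sum fun i _ => hasSum_sum fun j _ =>
      (hasSum_heatPairing ha (hdiag i).1 (hdiag j).1 (S i j)).mul_left _
  have h2 : HasSum (fun k : ℕ => ∑ i, x i ^ 2 *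
      (heatCoeff a k (S i i / 2) * heatCoeff a k (S i i / 2) * c ^ k / (k.factorial : ℝ)))
      (∑ i, x i ^ 2 * heatPairing a (S i i / 2) (S i i / 2) c) :=
    hasSum_sum fun i _ => (hasSum_heatPairing ha (hdiag i).1 (hdiag i).1 c).mul_left _
  have h3 : x ⬝ᵥ heatMatrix a S *ᵥ x =
      ∑ i, ∑ j, x i * x j * heatPairing a (S i i / 2) (S j j / 2) (S i j) := by
    simp only [dotProduct, mulVec, heatMatrix, of_apply, Finset.mul_sum]
    refine Finset.sum_congr rfl fun i _ => Finset.sum_congr rfl fun j _ => ?_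
    ring
  have h4 : h * (x ⬝ᵥ x) ≤ ∑ i, x i ^ 2 * heatPairing a (S i i / 2) (S i i / 2) c := by
    rw [dotProduct, Finset.mul_sum]
    refine Finset.sum_le_sum fun i _ => ?_
    rw [← sq, mul_comm]
    exact mul_le_mul_of_nonneg_left (hh _ (hdiag i)) (sq_nonneg _)
  rw [h3]
  refine h4.trans (hasSum_le (fun k => ?_) h2 h1)
  rcases eq_or_ne k 0 with rfl | hk
  · have h0 : ∀ z, heatCoeff a 0 z = 0 := fun z => heatCoeff_even heven 0 z
    simp [h0]
  -- For each `k` the factors `F_k(S_ii/2)` are absorbed into the test vector.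
  · have h5 := le_sum_hadamardPow hc hS hk fun i => x i * heatCoeff a k (S i i / 2)
    have h6 := div_le_div_of_nonneg_right h5 (Nat.cast_nonneg (α := ℝ) k.factorial)
    refine (Eq.le ?_).trans (h6.trans (Eq.le ?_))
    · rw [Finset.mul_sum, Finset.sum_div]
      refine Finset.sum_congr rfl fun i _ => ?_
      ring
    · rw [Finset.sum_div]
      refine Finset.sum_congr rfl fun i _ => ?_
      rw [Finset.sum_div]
      refine Finset.sum_congr rfl fun j _ => ?_
      ring

theorem l2_opNorm_heatMatrix_sub_le {n : Type*} [Fintype n] [DecidableEq n] {B S : Matrix n n ℝ}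
    {K R ε : ℝ} (ha : ∀ n, |a n| ≤ N)
    (heven : ∀ n, a (2 * n) = 0) (hR : 1 ≤ R) (hεR : ε ≤ R) (hε : 0 ≤ ε)
    (hK : Fintype.card n * ε ≤ K) (hB : ∀ i, B i i = 0) (hdiag : ∀ i, S i i ∈ Set.Icc 0 R)
    (h1 : ‖S - 1‖ ≤ ε) (h2 : ‖S - 1 + B‖ ≤ ε ^ 2) :
    ‖heatMatrix a S - (heatPairing a (1 / 2) (1 / 2) 1 • (1 : Matrix n n ℝ) -
        heatCoeff a 1 (1 / 2) ^ 2 • B)‖ ≤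
      (2 * heatCoeff a 1 (1 / 2) ^ 2 + 2 * (N * Real.exp R) ^ 2 * Real.exp (2 * R) +
        2 * (N * Real.exp R) ^ 2 * Real.exp R * K) * ε ^ 2 := by
  set l := heatCoeff a 1 (1 / 2) ^ 2 with hl
  set κ := heatPairing a (1 / 2) (1 / 2) 1
  set M := N * Real.exp R
  have hl0 : 0 ≤ l := sq_nonneg _
  -- The zero diagonal of `B` makes the diagonal deviation second order.
  have hd : ∀ i, |S i i - 1| ≤ ε ^ 2 := fun i => by
    have := (abs_apply_le_l2_opNorm (S - 1 + B) i i).trans h2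
    simpa [hB i] using this
  have ho : ∀ i j, i ≠ j → |S i j| ≤ ε := fun i j hij => by
    have := (abs_apply_le_l2_opNorm (S - 1) i j).trans h1
    simpa [hij] using this
  -- Subtracting `l • (S - 1 + B)` trades `-B` for `S - 1`, so that off the diagonal each entry is
  -- compared with `l * S i j`.
  have key : ‖heatMatrix a S - (κ • (1 : Matrix n n ℝ) - l • B) - l • (S - 1 + B)‖ ≤
      (2 * M ^ 2 * ε ^ 2 * Real.exp (2 * R) + l * ε ^ 2) +
        Fintype.card n * (2 * M ^ 2 * ε ^ 3 * Real.exp R) := by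
    refine l2_opNorm_le_of_diag_of_offDiag (by positivity) (by positivity) (fun i => ?_)
      fun i j hij => ?_
    · have e : (heatMatrix a S - (κ • (1 : Matrix n n ℝ) - l • B) - l • (S - 1 + B)) i i =
          (heatPairing a (S i i / 2) (S i i / 2) (S i i) - κ) - l * (S i i - 1) := by
        simp [heatMatrix, hB i]
      rw [e]
      refine (abs_sub _ _).trans (add_le_add ?_ ?_)
      · refine (abs_heatPairing_diag_sub_le ha hR (hdiag i)).trans ?_
        gcongr
        exact hd i
      · rw [abs_mul, abs_of_nonneg hl0]
        exact mul_le_mul_of_nonneg_left (hd i) hl0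
    · have e : (heatMatrix a S - (κ • (1 : Matrix n n ℝ) - l • B) - l • (S - 1 + B)) i j =
          heatPairing a (S i i / 2) (S j j / 2) (S i j) - l * S i j := by
        simp [heatMatrix, hij]
      rw [e]
      exact abs_heatPairing_sub_linear_le ha heven hR hεR (hdiag i) (hdiag j) (hd i) (hd j)
        (ho i j hij)
  have h3 : ‖l • (S - 1 + B)‖ ≤ l * ε ^ 2 := by
    rw [norm_smul, Real.norm_of_nonneg hl0]
    exact mul_le_mul_of_nonneg_left h2 hl0
  have h4 : Fintype.card n * (2 * M ^ 2 * ε ^ 3 * Real.exp R) ≤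
      2 * M ^ 2 * Real.exp R * K * ε ^ 2 := by
    calc _ = 2 * M ^ 2 * Real.exp R * (Fintype.card n * ε) * ε ^ 2 := by ring
      _ ≤ _ := by gcongr
  have h5 := norm_le_norm_sub_add (heatMatrix a S - (κ • (1 : Matrix n n ℝ) - l • B))
    (l • (S - 1 + B))
  refine h5.trans ((add_le_add key h3).trans ?_)
  linarith

/-- With `A` the approximate inverse and `E` the error in `T`, `T A = 1 - (l/κ)² B² + E A`; then
`T⁻¹ - A = T⁻¹ (1 - T A)`. -/
theorem l2_opNorm_inv_sub_le {n : Type*} [Fintype n] [DecidableEq n] {T B : Matrix n n ℝ}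
    {κ l h C ε : ℝ} (hκ : 0 < κ) (hl : 0 ≤ l) (hh : 0 < h) (hC : 0 ≤ C) (hT : IsUnit T)
    (hT' : ‖T⁻¹‖ ≤ h⁻¹) (hE : ‖T - (κ • 1 - l • B)‖ ≤ C * ε ^ 2) (hB : ‖B‖ ≤ ε)
    (hB1 : ‖B‖ ≤ 1) :
    ‖T⁻¹ - (κ⁻¹ • 1 + (l / κ ^ 2) • B)‖ ≤
      h⁻¹ * ((l / κ) ^ 2 + C * (κ⁻¹ + l / κ ^ 2)) * ε ^ 2 := by
  have hTi : T⁻¹ * T = 1 := nonsing_inv_mul _ ((isUnit_iff_isUnit_det T).1 hT)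
  set E := T - (κ • 1 - l • B) with hEdef
  set A : Matrix n n ℝ := κ⁻¹ • 1 + (l / κ ^ 2) • B with hA
  have hprod : (κ • 1 - l • B) * A = 1 - (l / κ) ^ 2 • (B * B) := by
    simp only [hA, mul_add, sub_mul, smul_mul_assoc, mul_smul_comm, one_mul, mul_one, smul_sub,
      smul_smul]
    have e1 : κ⁻¹ * κ = 1 := inv_mul_cancel₀ hκ.ne'
    have e2 : κ⁻¹ * l = l / κ := by ring
    have e3 : l / κ ^ 2 * κ = l / κ := by field_simp
    have e4 : l / κ ^ 2 * l = (l / κ) ^ 2 := by ring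
    rw [e1, e2, e3, e4, one_smul]
    abel
  have key : T⁻¹ - A = T⁻¹ * ((l / κ) ^ 2 • (B * B) - E * A) := by
    have e1 : T * A = 1 - (l / κ) ^ 2 • (B * B) + E * A := by
      rw [← hprod, ← add_mul, hEdef, add_sub_cancel]
    have e2 : (l / κ) ^ 2 • (B * B) - E * A = 1 - T * A := by
      rw [e1]
      abel
    rw [e2, mul_sub, mul_one, ← mul_assoc, hTi, one_mul]
  have hA' : ‖A‖ ≤ κ⁻¹ + l / κ ^ 2 := by
    refine (norm_add_le _ _).trans (add_le_add ?_ ?_)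
    · rw [norm_smul, Real.norm_of_nonneg (by positivity)]
      exact mul_le_of_le_one_right (by positivity) l2_opNorm_one_le
    · rw [norm_smul, Real.norm_of_nonneg (by positivity)]
      exact mul_le_of_le_one_right (by positivity) hB1
  have hBB : ‖(l / κ) ^ 2 • (B * B)‖ ≤ (l / κ) ^ 2 * ε ^ 2 := by
    rw [norm_smul, Real.norm_of_nonneg (by positivity), sq ε]
    gcongr
    exact (l2_opNorm_mul _ _).trans (mul_le_mul hB hB (norm_nonneg _) ((norm_nonneg _).trans hB))
  have hEA : ‖E * A‖ ≤ C * ε ^ 2 * (κ⁻¹ + l / κ ^ 2) :=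
    (l2_opNorm_mul _ _).trans (mul_le_mul hE hA' (norm_nonneg _) (by positivity))
  rw [key]
  calc _ ≤ ‖T⁻¹‖ * ‖(l / κ) ^ 2 • (B * B) - E * A‖ := l2_opNorm_mul _ _
    _ ≤ h⁻¹ * ((l / κ) ^ 2 * ε ^ 2 + C * ε ^ 2 * (κ⁻¹ + l / κ ^ 2)) :=
        mul_le_mul hT' ((norm_sub_le _ _).trans (add_le_add hBB hEA)) (norm_nonneg _)
          (by positivity)
    _ = _ := by ring

end Covariance

/-! ### The main theorem -/

/-- Matrix norms are operator norms with respect to the Euclidean norm. -/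
theorem mainTheorem2 (f : ℝ → ℝ) (hodd : Function.Odd f)
    (hbdd : ∃ N : ℝ, ∀ n : ℕ, |iteratedDeriv n f 0| ≤ N)
    (htaylor : ∀ x : ℝ,
      HasSum (fun n : ℕ => iteratedDeriv n f 0 / (n.factorial : ℝ) * x ^ n) (f x)) :
    (f ≠ 0 → 0 < kappa f) ∧
    ∀ K : ℝ, ∃ C : ℝ, ∀ (d : ℕ) (B : Matrix (Fin d) (Fin d) ℝ) (δ ε : ℝ),
      B.IsSymm → (∀ i, B i i = 0) → ‖B‖ ≤ δ → δ < 1 → ε = δ / (1 - δ) → (d : ℝ) * ε ≤ K →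
        (∀ i, MemLp (fun x => f (x i)) 2 (gaussianOfPrecision (1 + B))) ∧
        ‖transformedCov f (1 + B) -
            (kappa f • (1 : Matrix (Fin d) (Fin d) ℝ) - lam f • B)‖ ≤ C * ε ^ 2 ∧
        (f ≠ 0 →
          IsUnit (transformedCov f (1 + B)) ∧
          ‖(transformedCov f (1 + B))⁻¹ -
              ((kappa f)⁻¹ • (1 : Matrix (Fin d) (Fin d) ℝ)
                + (lam f / kappa f ^ 2) • B)‖ ≤ C * ε ^ 2) := by
  obtain ⟨N, ha⟩ := hbdd
  have heven := iteratedDeriv_two_mul_zero_of_odd hodd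
  have hκ := kappa_eq_heatPairing hodd ha
  have hpos : f ≠ 0 → 0 < kappa f := fun hf => by
    rw [hκ]
    exact heatPairing_self_pos ha (iteratedDeriv_zero_ne_zero htaylor hf) (by norm_num) one_pos
  refine ⟨hpos, fun K => ?_⟩
  set a : ℕ → ℝ := fun n => iteratedDeriv n f 0 with hadef
  have hlam : lam f = heatCoeff a 1 (1 / 2) ^ 2 := rfl
  have hl0 : 0 ≤ lam f := sq_nonneg _
  -- For `d ≥ 1` this bounds the variances: `S_ii ≤ (1 - δ)⁻¹ = 1 + ε ≤ 1 + |K|`.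
  set R := 1 + |K| with hRdef
  have hR : 1 ≤ R := by linarith [abs_nonneg K]
  set C₁ := 2 * lam f + 2 * (N * Real.exp R) ^ 2 * Real.exp (2 * R) +
        2 * (N * Real.exp R) ^ 2 * Real.exp R * |K| with hC₁
  have hC₁0 : 0 ≤ C₁ := by positivity
  obtain ⟨h, hh0, hh⟩ : ∃ h > 0, f ≠ 0 → ∀ x ∈ Set.Icc 0 R, h ≤ heatPairing a x x (1 / 2) := by
    by_cases hf : f = 0
    · exact ⟨1, one_pos, fun h => (h hf).elim⟩
    · obtain ⟨h, hh0, hh⟩ := exists_pos_le_heatPairing_self ha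
        (iteratedDeriv_zero_ne_zero htaylor hf) R one_half_pos
      exact ⟨h, hh0, fun _ => hh⟩
  set C₂ := h⁻¹ * ((lam f / kappa f) ^ 2 + C₁ * ((kappa f)⁻¹ + lam f / kappa f ^ 2))
  refine ⟨max C₁ C₂, fun d B δ ε hB hBd hBδ hδ hε hK => ?_⟩
  have hB1 : ‖B‖ < 1 := hBδ.trans_lt hδ
  have hδ0 : 0 ≤ δ := (norm_nonneg _).trans hBδ
  have hε0 : 0 ≤ ε := by
    rw [hε]
    exact div_nonneg hδ0 (by linarith)
  have hPD := (posDef_one_add_of_l2_opNorm_lt_one hB hB1).inv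
  have hPS := hPD.posSemidef
  have hC₁le : C₁ * ε ^ 2 ≤ max C₁ C₂ * ε ^ 2 := by
    gcongr
    exact le_max_left _ _
  have hC₂le : C₂ * ε ^ 2 ≤ max C₁ C₂ * ε ^ 2 := by
    gcongr
    exact le_max_right _ _
  refine ⟨fun i => memLp_two_comp_eval ha htaylor hPS i, ?_⟩
  -- In dimension `0` the hypothesis `d ε ≤ K` does not control `ε`, but every matrix is zero.
  rcases Nat.eq_zero_or_pos d with rfl | hd
  · have hC0 : 0 ≤ max C₁ C₂ * ε ^ 2 := le_trans (by positivity) hC₁le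
    have hn : ∀ A : Matrix (Fin 0) (Fin 0) ℝ, ‖A‖ ≤ max C₁ C₂ * ε ^ 2 := fun A => by
      rw [Subsingleton.elim A 0, norm_zero]
      exact hC0
    exact ⟨hn _, fun _ => ⟨isUnit_of_subsingleton _, hn _⟩⟩
  have hcov : transformedCov f (1 + B) = heatMatrix a (1 + B)⁻¹ := by
    ext i j
    exact covariance_comp_eval hodd ha htaylor hPS i j
  have hεK : ε ≤ |K| := by
    have : (1 : ℝ) ≤ d := by exact_mod_cast hd
    nlinarith [le_abs_self K]
  have hdiag : ∀ i, (1 + B)⁻¹ i i ∈ Set.Icc 0 R := fun i => by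
    refine ⟨hPS.diag_nonneg, (le_abs_self _).trans ((abs_apply_le_l2_opNorm _ i i).trans
      ((l2_opNorm_inv_one_add_le hBδ hδ).trans ?_))⟩
    have : (1 - δ)⁻¹ = 1 + ε := by
      have : 1 - δ ≠ 0 := by linarith
      rw [hε]
      field_simp
      ring
    rw [this]
    linarith
  have hE : ‖transformedCov f (1 + B) -
      (kappa f • (1 : Matrix (Fin d) (Fin d) ℝ) - lam f • B)‖ ≤ C₁ * ε ^ 2 := by
    rw [hcov, hκ]
    refine l2_opNorm_heatMatrix_sub_le ha heven hR (by linarith) hε0 ?_ hBd hdiag ?_ ?_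
    · rw [Fintype.card_fin]
      exact hK.trans (le_abs_self K)
    · rw [hε]
      exact l2_opNorm_inv_one_add_sub_one_le hB hBδ hδ
    · rw [hε]
      exact l2_opNorm_inv_one_add_sub_one_add_le hB hBδ hδ
  refine ⟨hE.trans hC₁le, fun hf => ?_⟩
  have hquad : ∀ x : Fin d → ℝ, h * (dotProduct x x) ≤
      dotProduct x ((transformedCov f (1 + B)).mulVec x) := by
    rw [hcov]
    refine le_dotProduct_heatMatrix_mulVec ha heven (by norm_num)
      (posSemidef_inv_one_add_sub_half hB hB1) (fun i => ?_) (hh hf)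
    exact ⟨by linarith [(hdiag i).1], by linarith [(hdiag i).1, (hdiag i).2]⟩
  have hunit := isUnit_of_le_dotProduct_mulVec hh0 hquad
  refine ⟨hunit, le_trans ?_ hC₂le⟩
  refine l2_opNorm_inv_sub_le (hpos hf) hl0 hh0 hC₁0 hunit
    (l2_opNorm_inv_le_of_le_dotProduct_mulVec hh0 hquad) hE (hBδ.trans ?_) hB1.le
  rw [hε]
  exact le_div_self hδ0 (by linarith) (by linarith)
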